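/- Let $\alpha,\beta\in\mathbb R$, $s>\tfrac12$, and let $W(u,v)=\alpha|u|^2|v|^2+\beta(\bar u v+u\bar v)^2$, $N_1=\partial_{\bar u}W$, $N_2=\partial_{\bar v}W$ (Wirtinger derivatives) for $u,v\in\mathbb C$. Let $(u,v)\in C([0,\infty),H^s(\mathbb R))$ be any complex-valued global solution of the nonlinear massless Dirac system $$i(u_t+u_x)=N_1(u,v),\qquad i(v_t-v_x)=N_2(u,v),\qquad (u,v)|_{t=0}=(u_0,v_0),$$ where the equations hold in the sense of distributions on $\mathbb R\times(0,\infty)$ and $u(\cdot,t),v(\cdot,t)$ denote the continuous representatives. For $y\in\mathbb R$ put $$G_1(y)=-i\int_0^\infty N_1\big(u(y+\tau,\tau),v(y+\tau,\tau)\big)\,d\tau,\qquad G_2(y)=-i\int_0^\infty N_2\big(u(y-\tau,\tau),v(y-\tau,\tau)\big)\,d\tau .$$ Then these integrals converge absolutely for every $y$, $$\lim_{t\to\infty}\int_{-\infty}^\infty|u(x,t)-u_0(x-t)-G_1(x-t)|^2\,dx=0,\qquad \lim_{t\to\infty}\int_{-\infty}^\infty|v(x,t)-v_0(x+t)-G_2(x+t)|^2\,dx=0,$$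 and $$\lim_{t\to\infty}\sup_{x\in\mathbb R}|u(x,t)-u_0(x-t)-G_1(x-t)|=0,\qquad \lim_{t\to\infty}\sup_{x\in\mathbb R}|v(x,t)-v_0(x+t)-G_2(x+t)|=0,$$ all these integrals and suprema being finite for every $t\ge 0$. -/

import Mathlib

open MeasureTheory Set Filter Topology
open scoped ComplexConjugate SchwartzMap ContDiff

noncomputable section

namespace DiracAsymptotics

/-- The Wirtinger derivative `∂f/∂z̄ = (∂f/∂x + i ∂f/∂y) / 2` of `f` at `z = x + i y`. -/
def dbar (f : ℂ → ℂ) (z : ℂ) : ℂ :=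
  (1 / 2) * (fderiv ℝ f z 1 + Complex.I * fderiv ℝ f z Complex.I)

/-- The potential `W(u, v) = α |u|² |v|² + β (ū v + u v̄)²`. -/
def W (α β : ℝ) (u v : ℂ) : ℂ :=
  (α : ℂ) * (‖u‖ : ℂ) ^ 2 * (‖v‖ : ℂ) ^ 2 + (β : ℂ) * (conj u * v + u * conj v) ^ 2

/-- The nonlinear term `N₁ = ∂W/∂ū`. -/
def N₁ (α β : ℝ) (u v : ℂ) : ℂ := dbar (fun z => W α β z v) u

/-- The nonlinear term `N₂ = ∂W/∂v̄`. -/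
def N₂ (α β : ℝ) (u v : ℂ) : ℂ := dbar (fun z => W α β u z) v

/-- `f ∈ C([0, ∞), H^s(ℝ))`, for `s ≥ 0`, where `f t : ℝ → ℂ` is the value at time `t`: every
`f t` with `t ≥ 0` is in `L²`, its Bessel potential `w t = (1 - (2π)⁻² ∂ₓ²)^{s/2} f t` is in `L²`,
and `w` is continuous on `[0, ∞)` as a map into `L²` (the `H^s` norm of `f t` is the `L²` norm
of `w t`, up to equivalence). -/
def ContinuousInSobolev (s : ℝ) (f : ℝ → ℝ → ℂ) : Prop :=
  ∃ (hf : ∀ t : ℝ, 0 ≤ t → MemLp (f t) 2 volume) (w : ℝ → Lp ℂ 2 (volume : Measure ℝ)),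
    ContinuousOn w (Ici 0) ∧
    ∀ (t : ℝ) (ht : 0 ≤ t),
      TemperedDistribution.besselPotential ℝ ℂ s ((hf t ht).toLp (f t) : 𝓢'(ℝ, ℂ)) =
        (w t : 𝓢'(ℝ, ℂ))

/-- Test functions on the open half plane `ℝ × (0, ∞)` of points `(x, t)`. -/
structure IsTest (φ : ℝ × ℝ → ℂ) : Prop where
  smooth : ContDiff ℝ ∞ φ
  compact : HasCompactSupport φ
  support : tsupport φ ⊆ {p : ℝ × ℝ | 0 < p.2}

/-- `(u, v)` is a solution in `C([0, ∞), H^s(ℝ))`, with initial data `(u₀, v₀)`, of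
`i (u_t + u_x) = N₁(u, v)`, `i (v_t - v_x) = N₂(u, v)`.
Here `u t x` is the value at time `t ≥ 0` and position `x` (values at `t < 0` are irrelevant).
The equations hold in the sense of distributions on `ℝ × (0, ∞)`, and for each time the element
of `H^s`, `s > 1/2`, is represented by its continuous representative. -/
structure IsSolution (α β s : ℝ) (u₀ v₀ : ℝ → ℂ) (u v : ℝ → ℝ → ℂ) : Prop where
  sobolev_u : ContinuousInSobolev s u
  sobolev_v : ContinuousInSobolev s v
  continuous_u : ∀ t : ℝ, 0 ≤ t → Continuous (u t)
  continuous_v : ∀ t : ℝ, 0 ≤ t → Continuous (v t)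
  initial_u : u 0 = u₀
  initial_v : v 0 = v₀
  eq_u : ∀ φ : ℝ × ℝ → ℂ, IsTest φ →
    -Complex.I * ∫ p : ℝ × ℝ, u p.2 p.1 * (fderiv ℝ φ p (0, 1) + fderiv ℝ φ p (1, 0)) =
      ∫ p : ℝ × ℝ, N₁ α β (u p.2 p.1) (v p.2 p.1) * φ p
  eq_v : ∀ φ : ℝ × ℝ → ℂ, IsTest φ →
    -Complex.I * ∫ p : ℝ × ℝ, v p.2 p.1 * (fderiv ℝ φ p (0, 1) - fderiv ℝ φ p (1, 0)) =
      ∫ p : ℝ × ℝ, N₂ α β (u p.2 p.1) (v p.2 p.1) * φ p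

/-- `G₁(y) = -i ∫₀^∞ N₁(u(y + τ, τ), v(y + τ, τ)) dτ`. -/
def G₁ (α β : ℝ) (u v : ℝ → ℝ → ℂ) (y : ℝ) : ℂ :=
  -Complex.I * ∫ τ in Ioi (0 : ℝ), N₁ α β (u τ (y + τ)) (v τ (y + τ))

/-- `G₂(y) = -i ∫₀^∞ N₂(u(y - τ, τ), v(y - τ, τ)) dτ`. -/
def G₂ (α β : ℝ) (u v : ℝ → ℝ → ℂ) (y : ℝ) : ℂ :=
  -Complex.I * ∫ τ in Ioi (0 : ℝ), N₂ α β (u τ (y - τ)) (v τ (y - τ))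

end DiracAsymptotics

end

/-! Along its own characteristic each component satisfies an ordinary differential equation, and the
nonlinearity obeys `‖N₁‖ ≤ C ‖u‖ ‖v‖²`. Thus u scatters along the line x = y + τ as soon as |v|² is
integrable in τ there. This integrability is conservation of charge in local form: the rate at which
|u|² grows is the rate at which |v|² decays (`chargeRate_swap`). Balancing charge over a
characteristic triangle bounds the charge of v crossing a characteristic of u by half of the total
initial charge (`integral_flux_le`). Grönwall's inequality then gives |u(y + t, t)| ≤ B |u₀(y)|, and
by reflection |v(y + t, t)| ≤ B' |v₀(y + 2t)| (`exists_norm_le`). The remainder is the tail of the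
integral defining G₁, so it is at most a constant times |u₀(x - t)| ∫_{x+t}^∞ |v₀|². Since u₀ is in
L² and vanishes at infinity, this tends to zero in L² and uniformly (`remainder_tendsto_zero`).
Sobolev regularity serves only to provide joint continuity and decay of the data at infinity; with
continuity, the distributional equations become integral equations along every characteristic. -/

namespace DiracAsymptotics

open FourierTransform TemperedDistribution

/-! ### Sobolev embedding and joint continuity. -/

theorem memLp_one_add_sq_rpow {s : ℝ} (hs : 1 / 2 < s) :
    MemLp (fun x : ℝ => (((1 + ‖x‖ ^ 2) ^ (-s / 2) : ℝ) : ℂ)) 2 := by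
  have : MemLp (fun x : ℝ => (1 + ‖x‖ ^ 2) ^ (-s / 2)) 2 := by
    have hcont : Continuous fun x : ℝ => (1 + ‖x‖ ^ 2) ^ (-s / 2) :=
      Continuous.rpow_const (by fun_prop) fun x => Or.inl (by positivity)
    rw [memLp_two_iff_integrable_sq hcont.aestronglyMeasurable]
    have h := integrable_rpow_neg_one_add_norm_sq (E := ℝ) (μ := volume) (r := 2 * s)
      (by simp; linarith)
    refine h.congr (Eventually.of_forall fun x => ?_)
    simp only
    rw [← Real.rpow_mul_natCast (by positivity)]
    congr 1
    push_cast
    ring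
  exact this.ofReal

/-- A bound, by the Sobolev norm, for the `L¹` norm of the Fourier transform. -/
theorem exists_fourier_eq_L1 {s : ℝ} (hs : 1 / 2 < s) :
    ∃ C : ℝ, ∀ (f : 𝓢'(ℝ, ℂ)) (w : Lp ℂ 2 (volume : Measure ℝ)),
      besselPotential ℝ ℂ s f = (w : 𝓢'(ℝ, ℂ)) →
      ∃ g : Lp ℂ 1 (volume : Measure ℝ), 𝓕 f = (g : 𝓢'(ℝ, ℂ)) ∧ ‖g‖ ≤ C * ‖w‖ := by
  have hm := memLp_one_add_sq_rpow hs
  -- The Fourier transform of `f` is the weight (1 + |ξ|²)^(-s/2) times that of `w`. Both factors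
  -- are in L², so Hölder and Plancherel give the bound.
  refine ⟨‖hm.toLp‖, fun f w hf => ⟨hm.toLp • 𝓕 w, ?_, ?_⟩⟩
  · have h1 : smulLeftCLM ℂ (fun x : ℝ => (((1 + ‖x‖ ^ 2) ^ (s / 2) : ℝ) : ℂ)) (𝓕 f)
        = ((𝓕 w : Lp ℂ 2 (volume : Measure ℝ)) : 𝓢'(ℝ, ℂ)) := by
      rw [← Lp.fourier_toTemperedDistribution_eq, ← hf,
        fourier_besselPotential_eq_smulLeftCLM_fourier_apply]
    rw [MeasureTheory.Lp.toTemperedDistribution_smul_eq (by fun_prop), ← h1,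
      smulLeftCLM_smulLeftCLM_apply (by fun_prop) (by fun_prop)]
    convert! (smulLeftCLM_const 1 (𝓕 f)).symm using 1
    · simp
    · congr
      ext x
      rw [Pi.mul_apply]
      norm_cast
      rw [← Real.rpow_add (by positivity)]
      ring_nf
      simp
  · refine (Lp.norm_smul_le _ _).trans ?_
    rw [Lp.norm_fourier_eq]

/-- Pairing with a test function moves the inverse transform onto `g`, which gives equality almost
everywhere. Both sides are continuous, so it holds everywhere. -/
theorem eq_fourierInv_of_fourier_eq_L1 {f : ℝ → ℂ} (hc : Continuous f) (hf : MemLp f 2 volume)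
    (g : Lp ℂ 1 (volume : Measure ℝ)) (h : 𝓕 (hf.toLp f : 𝓢'(ℝ, ℂ)) = (g : 𝓢'(ℝ, ℂ))) :
    f = 𝓕⁻ (g : ℝ → ℂ) := by
  have hg : Integrable (g : ℝ → ℂ) := L1.integrable_coeFn g
  have hgc : Continuous (𝓕⁻ (g : ℝ → ℂ)) := by
    rw [← Real.Lp.coe_fourierTransformInv]
    exact (Real.Lp.fourierTransformInv g).continuous
  rw [← Continuous.ae_eq_iff_eq volume hc hgc]
  apply ae_eq_of_integral_contDiff_smul_eq hc.locallyIntegrable hgc.locallyIntegrable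
  intro φ hφ hφc
  have hg₁ : HasCompactSupport (Complex.ofRealCLM ∘ φ) := hφc.comp_left rfl
  have hg₂ : ContDiff ℝ ∞ (Complex.ofRealCLM ∘ φ) := by fun_prop
  set ψ : 𝓢(ℝ, ℂ) := hg₁.toSchwartzMap hg₂
  have h1 : (hf.toLp f : 𝓢'(ℝ, ℂ)) ψ = (g : 𝓢'(ℝ, ℂ)) (𝓕⁻ ψ) := by
    rw [← h]
    simp
  rw [Lp.toTemperedDistribution_apply, Lp.toTemperedDistribution_apply] at h1
  have h2 : ∫ x, ψ x • hf.toLp f x = ∫ x, φ x • f x := by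
    apply integral_congr_ae
    filter_upwards [hf.coeFn_toLp] with x hx
    rw [hx]
    simp [ψ]
  rw [← h2, h1]
  -- The minus sign in the bilinear form makes this the self-adjointness of the inverse transform.
  have h3 := VectorFourier.integral_fourierIntegral_smul_eq_flip (L := -innerₗ ℝ)
    (μ := volume) (ν := volume) Real.continuous_fourierChar
    (by simp only [LinearMap.neg_apply, innerₗ_apply_apply]; fun_prop) ψ.integrable hg
  simp only [VectorFourier.fourierIntegral, LinearMap.neg_apply, neg_neg, LinearMap.flip_apply,
    innerₗ_apply_apply] at h3
  simp only [SchwartzMap.fourierInv_coe, Real.fourierInv_eq]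
  rw [h3]
  refine integral_congr_ae (Eventually.of_forall fun x => ?_)
  simp [ψ, mul_comm]

/-- The Sobolev embedding of `H^s(ℝ)`, `s > 1/2`, into the continuous functions vanishing at
infinity. -/
theorem exists_norm_le_sobolev {s : ℝ} (hs : 1 / 2 < s) :
    ∃ C : ℝ, ∀ (f : ℝ → ℂ) (_ : Continuous f) (hf : MemLp f 2 volume)
      (w : Lp ℂ 2 (volume : Measure ℝ)),
      besselPotential ℝ ℂ s (hf.toLp f : 𝓢'(ℝ, ℂ)) = (w : 𝓢'(ℝ, ℂ)) →
      (∀ x, ‖f x‖ ≤ C * ‖w‖) ∧ Tendsto f (cocompact ℝ) (𝓝 0) := by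
  obtain ⟨C, hC⟩ := exists_fourier_eq_L1 hs
  refine ⟨C, fun f hc hf w hw => ?_⟩
  obtain ⟨g, hg, hgn⟩ := hC _ _ hw
  have hfg := eq_fourierInv_of_fourier_eq_L1 hc hf g hg
  constructor
  · intro x
    refine le_trans ?_ hgn
    rw [hfg, Real.fourierInv_eq, L1.norm_eq_integral_norm]
    refine (norm_integral_le_integral_norm _).trans (le_of_eq ?_)
    simp [Circle.norm_smul]
  · rw [hfg]
    -- Riemann–Lebesgue lemma.
    have h := (Real.zero_at_infty_fourier (g : ℝ → ℂ)).comp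
      (Homeomorph.neg ℝ).isClosedEmbedding.tendsto_cocompact
    refine h.congr fun x => ?_
    simp [Real.fourierInv_eq_fourier_neg]

theorem ContinuousInSobolev.tendsto_cocompact {s : ℝ} (hs : 1 / 2 < s) {f : ℝ → ℝ → ℂ}
    (h : ContinuousInSobolev s f) (hc : ∀ t, 0 ≤ t → Continuous (f t)) {t : ℝ} (ht : 0 ≤ t) :
    Tendsto (f t) (cocompact ℝ) (𝓝 0) := by
  obtain ⟨C, hC⟩ := exists_norm_le_sobolev hs
  obtain ⟨hf, w, -, hw⟩ := h
  exact (hC _ (hc t ht) (hf t ht) _ (hw t ht)).2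

/-- Joint continuity, with the values at negative times replaced by the initial value. -/
theorem ContinuousInSobolev.continuous_uncurry {s : ℝ} (hs : 1 / 2 < s) {f : ℝ → ℝ → ℂ}
    (h : ContinuousInSobolev s f) (hc : ∀ t, 0 ≤ t → Continuous (f t)) :
    Continuous fun p : ℝ × ℝ => f (max p.1 0) p.2 := by
  obtain ⟨C, hC⟩ := exists_norm_le_sobolev hs
  obtain ⟨hf, w, hw, hfw⟩ := h
  -- The embedding, applied to a difference of two times, makes continuity in time uniform in x.
  have hsub : ∀ t t' : ℝ, 0 ≤ t → 0 ≤ t' → ∀ x, ‖f t x - f t' x‖ ≤ C * ‖w t - w t'‖ := by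
    intro t t' ht ht' x
    refine (hC (f t - f t') ((hc t ht).sub (hc t' ht')) ((hf t ht).sub (hf t' ht'))
      (w t - w t') ?_).1 x
    rw [MemLp.toLp_sub (hf t ht) (hf t' ht'), ← Lp.toTemperedDistributionCLM_apply, ← Lp.toTemperedDistributionCLM_apply,
      map_sub, map_sub, map_sub]
    simp only [Lp.toTemperedDistributionCLM_apply, hfw t ht, hfw t' ht']
  rw [continuous_iff_continuousAt]
  rintro ⟨t₀, x₀⟩
  have hw' : Continuous fun p : ℝ × ℝ => w (max p.1 0) :=
    hw.comp_continuous (by fun_prop) fun p => mem_Ici.2 (le_max_right _ _)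
  have h1 : Tendsto (fun p : ℝ × ℝ => f (max p.1 0) p.2 - f (max t₀ 0) p.2) (𝓝 (t₀, x₀)) (𝓝 0) := by
    refine squeeze_zero_norm (a := fun p : ℝ × ℝ => C * ‖w (max p.1 0) - w (max t₀ 0)‖)
      (fun p => hsub _ _ (le_max_right _ _) (le_max_right _ _) _) ?_
    have : Continuous fun p : ℝ × ℝ => C * ‖w (max p.1 0) - w (max t₀ 0)‖ :=
      continuous_const.mul (hw'.sub continuous_const).norm
    simpa using this.tendsto (t₀, x₀)
  have h2 : Tendsto (fun p : ℝ × ℝ => f (max t₀ 0) p.2) (𝓝 (t₀, x₀)) (𝓝 (f (max t₀ 0) x₀)) :=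
    ((hc _ (le_max_right _ _)).comp continuous_snd).tendsto (t₀, x₀)
  simpa [ContinuousAt] using h1.add h2

/-! ### From distributional to integral equations along characteristics. -/

open scoped Convolution

/-- The lemma of du Bois-Reymond on the half line. -/
theorem eq_of_integral_deriv_smul_eq_zero {H : ℝ → ℂ} (hH : Continuous H)
    (h : ∀ b : ℝ → ℝ, ContDiff ℝ ∞ b → HasCompactSupport b → tsupport b ⊆ Ioi 0 →
      ∫ t, deriv b t • H t = 0) {t : ℝ} (ht : 0 ≤ t) : H t = H 0 := by
  let φ : ℕ → ContDiffBump (0 : ℝ) := fun n =>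
    ⟨1 / ((n : ℝ) + 1) / 2, 1 / ((n : ℝ) + 1), by positivity, half_lt_self (by positivity)⟩
  have hφ : Tendsto (fun n => (φ n).rOut) atTop (𝓝 0) := tendsto_one_div_add_atTop_nhds_zero_nat
  have hlim := fun x => ContDiffBump.convolution_tendsto_right_of_continuous (μ := volume) hφ hH x
  have hd : ∀ n, ∀ x, HasDerivAt ((φ n).normed volume ⋆[ContinuousLinearMap.lsmul ℝ ℝ, volume] H)
      ((deriv ((φ n).normed volume) ⋆[ContinuousLinearMap.lsmul ℝ ℝ, volume] H) x) x := fun n x =>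
    (φ n).hasCompactSupport_normed.hasDerivAt_convolution_left _ (φ n).contDiff_normed
      hH.locallyIntegrable x
  -- The mollifier centred at x > `rOut` is itself an admissible test function, so the mollified `H`
  -- has zero derivative there. Letting the radius shrink makes `H` constant on (0, ∞).
  have hz : ∀ n, ∀ x ∈ Ioi (φ n).rOut,
      (deriv ((φ n).normed volume) ⋆[ContinuousLinearMap.lsmul ℝ ℝ, volume] H) x = 0 := by
    intro n x hx
    rw [convolution_eq_swap]
    have hb := h (fun s => (φ n).normed volume (x - s))
      ((φ n).contDiff_normed.comp (contDiff_const.sub contDiff_id))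
      ((φ n).hasCompactSupport_normed.comp_homeomorph (Homeomorph.subLeft x)) ?_
    · simp only [deriv_comp_const_sub, neg_smul, integral_neg, neg_eq_zero] at hb
      simpa using hb
    · have : tsupport (fun s => (φ n).normed volume (x - s)) ⊆ Metric.closedBall x (φ n).rOut := by
        refine closure_minimal (fun s hs => ?_) Metric.isClosed_closedBall
        have hs' : x - s ∈ Function.support ((φ n).normed volume) := hs
        rw [(φ n).support_normed_eq, Metric.mem_ball, dist_zero_right] at hs'
        rw [Metric.mem_closedBall, dist_comm, Real.dist_eq]
        exact hs'.le
      refine this.trans fun s hs => ?_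
      rw [Metric.mem_closedBall, Real.dist_eq, abs_le] at hs
      rw [mem_Ioi] at hx ⊢
      linarith
  have hconst : ∀ x > 0, ∀ y > 0, H x = H y := by
    intro x hx y hy
    refine tendsto_nhds_unique ((hlim x).congr' ?_) (hlim y)
    filter_upwards [hφ.eventually_lt_const hx, hφ.eventually_lt_const hy] with n hnx hny
    exact isOpen_Ioi.is_const_of_deriv_eq_zero isPreconnected_Ioi
      (fun z _ => (hd n z).differentiableAt.differentiableWithinAt)
      (fun z hz' => (hd n z).deriv.trans (hz n z hz')) hnx hny
  rcases ht.eq_or_lt with rfl | ht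
  · rfl
  have h0 : Tendsto H (𝓝[>] 0) (𝓝 (H 0)) := (hH.tendsto 0).mono_left nhdsWithin_le_nhds
  refine tendsto_nhds_unique (tendsto_const_nhds.congr' ?_) h0
  filter_upwards [self_mem_nhdsWithin] with x hx
  exact hconst t ht x hx

/-- A continuous weak solution of `g' = F` on the half line is a primitive of `F`. -/
theorem eq_add_integral_of_weak {g F : ℝ → ℂ} (hg : Continuous g) (hF : Continuous F)
    (h : ∀ b : ℝ → ℝ, ContDiff ℝ ∞ b → HasCompactSupport b → tsupport b ⊆ Ioi 0 →
      ∫ t, (deriv b t • g t + b t • F t) = 0) {t : ℝ} (ht : 0 ≤ t) :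
    g t = g 0 + ∫ τ in (0 : ℝ)..t, F τ := by
  set P : ℝ → ℂ := fun t => ∫ τ in (0 : ℝ)..t, F τ
  have hP : ∀ t, HasDerivAt P (F t) t := fun t =>
    intervalIntegral.integral_hasDerivAt_right (hF.intervalIntegrable _ _)
      (hF.stronglyMeasurableAtFilter _ _) hF.continuousAt
  have hPc : Continuous P := continuous_iff_continuousAt.2 fun t => (hP t).continuousAt
  -- Integration by parts turns the hypothesis into the du Bois-Reymond condition for g - P.
  have key : ∀ t, 0 ≤ t → g t - P t = g 0 - P 0 := by
    intro t ht
    refine eq_of_integral_deriv_smul_eq_zero (H := fun t => g t - P t) (hg.sub hPc) ?_ ht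
    intro b hb hbc hbs
    have hb' : Continuous (deriv b) := hb.continuous_deriv (by simp)
    have hbc' : HasCompactSupport (deriv b) := hbc.deriv
    have i1 : Integrable fun t => deriv b t • g t :=
      (hb'.smul hg).integrable_of_hasCompactSupport hbc'.smul_right
    have i2 : Integrable fun t => b t • F t :=
      (hb.continuous.smul hF).integrable_of_hasCompactSupport hbc.smul_right
    have i3 : Integrable fun t => deriv b t • P t :=
      (hb'.smul hPc).integrable_of_hasCompactSupport hbc'.smul_right
    have i4 : Integrable fun t => b t • P t :=
      (hb.continuous.smul hPc).integrable_of_hasCompactSupport hbc.smul_right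
    have hparts := integral_bilinear_hasDerivAt_right_eq_neg_left_of_integrable
      (L := ContinuousLinearMap.lsmul ℝ ℝ (E := ℂ)) (u := b) (v := P) (u' := deriv b) (v' := F)
      (fun x _ => (hb.differentiable (by simp) x).hasDerivAt) (fun x _ => hP x) i2 i3 i4
    simp only [ContinuousLinearMap.lsmul_apply] at hparts
    have h0 := h b hb hbc hbs
    rw [integral_add i1 i2, hparts] at h0
    simp only [smul_sub]
    rw [integral_sub i1 i3]
    linear_combination h0
  have := key t ht
  simp only [P, intervalIntegral.integral_same, sub_zero] at this
  linear_combination this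

/-- Change of variables along the characteristics of slope `c`. -/
theorem integral_prod_characteristic (c : ℝ) {g : ℝ × ℝ → ℂ} (hg : Continuous g)
    (hgc : HasCompactSupport g) :
    ∫ p, g p = ∫ y, ∫ t, g (y + c * t, t) := by
  have h1 : Integrable g (volume.prod volume) := hg.integrable_of_hasCompactSupport hgc
  let e : ℝ × ℝ ≃ₜ ℝ × ℝ :=
    { toFun := fun p => (p.2 + c * p.1, p.1)
      invFun := fun p => (p.2, p.1 - c * p.2)
      left_inv := fun p => by simp
      right_inv := fun p => by simp
      continuous_toFun := by fun_prop
      continuous_invFun := by fun_prop }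
  have h2 : Integrable (Function.uncurry fun t y => g (y + c * t, t)) (volume.prod volume) :=
    (hg.comp e.continuous).integrable_of_hasCompactSupport (hgc.comp_homeomorph e)
  rw [Measure.volume_eq_prod, integral_prod_symm _ h1, ← integral_integral_swap h2]
  refine integral_congr_ae (Eventually.of_forall fun t => ?_)
  exact (integral_add_right_eq_self (fun x => g (x, t)) (c * t)).symm

/-- These test functions separate the label y = x - ct of a characteristic from the time t along it.
-/
theorem isTest_characteristic (c : ℝ) {a b : ℝ → ℝ} (ha : ContDiff ℝ ∞ a)
    (hac : HasCompactSupport a) (hb : ContDiff ℝ ∞ b) (hbc : HasCompactSupport b)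
    (hbs : tsupport b ⊆ Ioi 0) :
    IsTest fun p => ((a (p.1 - c * p.2) * b p.2 : ℝ) : ℂ) := by
  have hsub : tsupport (fun p : ℝ × ℝ => ((a (p.1 - c * p.2) * b p.2 : ℝ) : ℂ)) ⊆
      {p | p.1 - c * p.2 ∈ tsupport a ∧ p.2 ∈ tsupport b} := by
    refine closure_minimal (fun p hp => ?_) ?_
    · rw [Function.mem_support, Complex.ofReal_ne_zero, mul_ne_zero_iff] at hp
      exact ⟨subset_tsupport _ hp.1, subset_tsupport _ hp.2⟩
    · exact ((isClosed_tsupport a).preimage (by fun_prop)).inter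
        ((isClosed_tsupport b).preimage (by fun_prop))
  refine ⟨?_, ?_, fun p hp => hbs (hsub hp).2⟩
  · refine Complex.ofRealCLM.contDiff.comp (ContDiff.mul (ha.comp ?_) (hb.comp contDiff_snd))
    fun_prop
  · have hK : IsCompact ((fun q : ℝ × ℝ => (q.1 + c * q.2, q.2)) '' (tsupport a ×ˢ tsupport b)) :=
      (hac.isCompact.prod hbc.isCompact).image (by fun_prop)
    refine hK.of_isClosed_subset (isClosed_tsupport _) (hsub.trans fun p hp => ?_)
    exact ⟨(p.1 - c * p.2, p.2), ⟨hp.1, hp.2⟩, by simp⟩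

/-- The transport operator is the derivative in the direction (c, 1), along which the factor `a` is
constant. -/
theorem fderiv_characteristic (c : ℝ) {a b : ℝ → ℝ} (ha : ContDiff ℝ ∞ a) (hb : ContDiff ℝ ∞ b)
    (p : ℝ × ℝ) :
    fderiv ℝ (fun p : ℝ × ℝ => ((a (p.1 - c * p.2) * b p.2 : ℝ) : ℂ)) p (0, 1) +
      c * fderiv ℝ (fun p : ℝ × ℝ => ((a (p.1 - c * p.2) * b p.2 : ℝ) : ℂ)) p (1, 0) =
      ((a (p.1 - c * p.2) * deriv b p.2 : ℝ) : ℂ) := by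
  set φ : ℝ × ℝ → ℂ := fun p : ℝ × ℝ => ((a (p.1 - c * p.2) * b p.2 : ℝ) : ℂ)
  have hφ : ContDiff ℝ ∞ φ := by
    refine Complex.ofRealCLM.contDiff.comp (ContDiff.mul (ha.comp ?_) (hb.comp contDiff_snd))
    fun_prop
  have h1 : fderiv ℝ φ p (0, 1) + c * fderiv ℝ φ p (1, 0) = fderiv ℝ φ p (c, 1) := by
    have : ((c, 1) : ℝ × ℝ) = (0, 1) + c • (1, 0) := by simp
    rw [this, map_add, map_smul]
    simp
  rw [h1]
  have hl : HasDerivAt (fun s : ℝ => (p.1 + c * (s - p.2), s)) ((c, 1) : ℝ × ℝ) p.2 := by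
    refine HasDerivAt.prodMk ?_ (hasDerivAt_id _)
    simpa using (((hasDerivAt_id p.2).sub_const p.2).const_mul c).const_add p.1
  have h2 : HasDerivAt (fun s : ℝ => φ (p.1 + c * (s - p.2), s)) (fderiv ℝ φ p (c, 1)) p.2 := by
    have hf : HasFDerivAt φ (fderiv ℝ φ p) (p.1 + c * (p.2 - p.2), p.2) := by
      simpa using (hφ.differentiable (by simp) p).hasFDerivAt
    exact HasFDerivAt.comp_hasDerivAt (f := fun s : ℝ => (p.1 + c * (s - p.2), s)) p.2 hf hl
  have h3 : HasDerivAt (fun s : ℝ => φ (p.1 + c * (s - p.2), s))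
      ((a (p.1 - c * p.2) * deriv b p.2 : ℝ) : ℂ) p.2 := by
    have : (fun s : ℝ => φ (p.1 + c * (s - p.2), s)) =
        fun s => ((a (p.1 - c * p.2) * b s : ℝ) : ℂ) := by
      ext s
      simp only [φ]
      congr 3
      ring
    rw [this]
    exact ((hb.differentiable (by simp) p.2).hasDerivAt.const_mul _).ofReal_comp
  exact h2.unique h3

/-- A continuous distributional solution of `i (f_t + c f_x) = F` is a mild solution. -/
theorem eq_add_integral_of_distribution (c : ℝ) {f F : ℝ → ℝ → ℂ}
    (hf : Continuous fun p : ℝ × ℝ => f p.1 p.2) (hF : Continuous fun p : ℝ × ℝ => F p.1 p.2)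
    (h : ∀ φ : ℝ × ℝ → ℂ, IsTest φ →
      -Complex.I * ∫ p : ℝ × ℝ, f p.2 p.1 * (fderiv ℝ φ p (0, 1) + c * fderiv ℝ φ p (1, 0)) =
        ∫ p : ℝ × ℝ, F p.2 p.1 * φ p) (y : ℝ) {t : ℝ} (ht : 0 ≤ t) :
    f t (y + c * t) = f 0 y + ∫ τ in (0 : ℝ)..t, -Complex.I * F τ (y + c * τ) := by
  have hfc : Continuous fun q : ℝ × ℝ => f q.2 (q.1 + c * q.2) :=
    hf.comp (by fun_prop : Continuous fun q : ℝ × ℝ => (q.2, q.1 + c * q.2))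
  have hFc : Continuous fun q : ℝ × ℝ => -Complex.I * F q.2 (q.1 + c * q.2) :=
    continuous_const.mul (hF.comp (by fun_prop : Continuous fun q : ℝ × ℝ => (q.2, q.1 + c * q.2)))
  have key : ∀ b : ℝ → ℝ, ContDiff ℝ ∞ b → HasCompactSupport b → tsupport b ⊆ Ioi 0 →
      ∫ t, (deriv b t • f t (y + c * t) + b t • (-Complex.I * F t (y + c * t))) = 0 := by
    intro b hb hbc hbs
    have hb' : Continuous (deriv b) := hb.continuous_deriv (by simp)
    set J : ℝ → ℝ → ℂ := fun y t =>
      deriv b t • f t (y + c * t) + b t • (-Complex.I * F t (y + c * t))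
    have hJ : Continuous (Function.uncurry J) :=
      ((hb'.comp continuous_snd).smul hfc).add ((hb.continuous.comp continuous_snd).smul hFc)
    have hJ0 : ∀ y t, t ∉ tsupport b → J y t = 0 := by
      intro y t ht
      have h1 : b t = 0 := image_eq_zero_of_notMem_tsupport ht
      have h2 : deriv b t = 0 := by
        by_contra hne
        exact ht (support_deriv_subset hne)
      simp [J, h1, h2]
    have hcont : Continuous fun y => ∫ t, J y t := by
      rw [← continuousOn_univ]
      exact continuousOn_integral_of_compact_support hbc.isCompact hJ.continuousOn
        fun p x _ hx => hJ0 p x hx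
    -- Varying `a` shows that the time integral vanishes for almost every label y; its continuity in
    -- y removes the exceptional set.
    suffices h0 : (fun y => ∫ t, J y t) = fun _ => 0 from congrFun h0 y
    rw [← Continuous.ae_eq_iff_eq volume hcont continuous_const]
    refine ae_eq_zero_of_integral_contDiff_smul_eq_zero hcont.locallyIntegrable ?_
    intro a ha hac
    have hφ := isTest_characteristic c ha hac hb hbc hbs
    have hw := h _ hφ
    simp only [fderiv_characteristic c ha hb] at hw
    have hg : Continuous fun p : ℝ × ℝ => a (p.1 - c * p.2) • J (p.1 - c * p.2) p.2 :=
      (ha.continuous.comp (by fun_prop)).smul (hJ.comp (by fun_prop :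
        Continuous fun p : ℝ × ℝ => (p.1 - c * p.2, p.2)))
    have hK : IsCompact ((fun q : ℝ × ℝ => (q.1 + c * q.2, q.2)) '' (tsupport a ×ˢ tsupport b)) :=
      (hac.isCompact.prod hbc.isCompact).image (by fun_prop)
    have hgc : HasCompactSupport fun p : ℝ × ℝ =>
        a (p.1 - c * p.2) • J (p.1 - c * p.2) p.2 := by
      refine HasCompactSupport.intro hK fun p hp => ?_
      by_contra hne
      rw [smul_eq_zero, not_or] at hne
      refine hp ⟨(p.1 - c * p.2, p.2), ⟨subset_tsupport _ hne.1, ?_⟩, by simp⟩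
      by_contra hb0
      exact hne.2 (hJ0 _ _ hb0)
    have hchange := integral_prod_characteristic c hg hgc
    simp only [add_sub_cancel_right, integral_smul] at hchange
    rw [← hchange]
    have hdφ : Integrable fun p : ℝ × ℝ =>
        f p.2 p.1 * ((a (p.1 - c * p.2) * deriv b p.2 : ℝ) : ℂ) := by
      have hφ' := isTest_characteristic c ha hac (contDiff_infty_iff_deriv.1 hb).2 hbc.deriv
        ((closure_minimal support_deriv_subset (isClosed_tsupport b)).trans hbs)
      refine Continuous.integrable_of_hasCompactSupport ?_ hφ'.compact.mul_left
      exact (hf.comp continuous_swap).mul hφ'.smooth.continuous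
    have hFφ : Integrable fun p : ℝ × ℝ =>
        F p.2 p.1 * ((a (p.1 - c * p.2) * b p.2 : ℝ) : ℂ) := by
      refine Continuous.integrable_of_hasCompactSupport ?_ hφ.compact.mul_left
      exact (hF.comp continuous_swap).mul hφ.smooth.continuous
    calc ∫ p : ℝ × ℝ, a (p.1 - c * p.2) • J (p.1 - c * p.2) p.2
        = ∫ p : ℝ × ℝ, (f p.2 p.1 * ((a (p.1 - c * p.2) * deriv b p.2 : ℝ) : ℂ) +
            -Complex.I * (F p.2 p.1 * ((a (p.1 - c * p.2) * b p.2 : ℝ) : ℂ))) := by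
          refine integral_congr_ae (Eventually.of_forall fun p => ?_)
          simp only [J, sub_add_cancel, Complex.real_smul]
          push_cast
          ring
      _ = 0 := by
          rw [integral_add hdφ (hFφ.const_mul _), integral_const_mul, ← hw]
          linear_combination
            (∫ p : ℝ × ℝ, f p.2 p.1 * ((a (p.1 - c * p.2) * deriv b p.2 : ℝ) : ℂ)) * Complex.I_sq
  have := eq_add_integral_of_weak (g := fun t => f t (y + c * t))
    (F := fun t => -Complex.I * F t (y + c * t))
    (hfc.comp (by fun_prop : Continuous fun t : ℝ => (y, t)))
    (hFc.comp (by fun_prop : Continuous fun t : ℝ => (y, t))) key ht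
  simpa using this

/-! ### Algebra of the nonlinearity and of the charge. -/

theorem N₁_eq (α β : ℝ) (u v : ℂ) :
    N₁ α β u v = α * u * (‖v‖ : ℂ) ^ 2 + 2 * β * (conj u * v + u * conj v) * v := by
  have hW : (fun z => W α β z v) = fun z : ℂ =>
      (α : ℂ) * (‖v‖ : ℂ) ^ 2 * (z * conj z) + (β : ℂ) * (conj z * v + z * conj v) ^ 2 := by
    ext z
    rw [W, Complex.mul_conj']
    ring
  have hid : HasFDerivAt (fun z : ℂ => z) (ContinuousLinearMap.id ℝ ℂ) u := hasFDerivAt_id u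
  have hconj : HasFDerivAt (fun z : ℂ => conj z) (Complex.conjCLE : ℂ →L[ℝ] ℂ) u :=
    Complex.conjCLE.hasFDerivAt
  have h : HasFDerivAt (fun z : ℂ => (α : ℂ) * (‖v‖ : ℂ) ^ 2 * (z * conj z) +
      (β : ℂ) * (conj z * v + z * conj v) ^ 2) _ u := ((hid.mul hconj).const_mul ((α : ℂ) * (‖v‖ : ℂ) ^ 2)).add
    ((((hconj.mul_const v).add (hid.mul_const (conj v))).pow 2).const_mul (β : ℂ))
  rw [N₁, dbar, hW, HasFDerivAt.fderiv h]
  simp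
  linear_combination (1 / 2 * (α * (‖v‖ : ℂ) ^ 2 * (conj u - u) +
    2 * β * (conj u * v + u * conj v) * (conj v - v))) * Complex.I_sq

theorem N₂_eq_N₁ (α β : ℝ) (u v : ℂ) : N₂ α β u v = N₁ α β v u := by
  have : (fun z => W α β u z) = fun z => W α β z u := by
    ext z
    simp only [W]
    ring
  rw [N₂, N₁, this]

theorem continuous_N₁ (α β : ℝ) : Continuous fun p : ℂ × ℂ => N₁ α β p.1 p.2 := by
  simp only [N₁_eq]
  have := Complex.continuous_conj
  fun_prop

theorem norm_N₁_le (α β : ℝ) (u v : ℂ) :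
    ‖N₁ α β u v‖ ≤ (|α| + 4 * |β|) * ‖u‖ * ‖v‖ ^ 2 := by
  rw [N₁_eq]
  calc _ ≤ ‖(α : ℂ) * u * (‖v‖ : ℂ) ^ 2‖ + ‖2 * (β : ℂ) * (conj u * v + u * conj v) * v‖ :=
        norm_add_le _ _
    _ ≤ |α| * ‖u‖ * ‖v‖ ^ 2 + 2 * |β| * (‖u‖ * ‖v‖ + ‖u‖ * ‖v‖) * ‖v‖ := by
        simp only [norm_mul, norm_pow, Complex.norm_real, Real.norm_eq_abs, abs_norm,
          Complex.norm_ofNat]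
        gcongr
        refine (norm_add_le _ _).trans ?_
        simp
    _ = _ := by ring

/-- The rate of charge transfer from `v` to `u`. -/
noncomputable def chargeRate (α β : ℝ) (u v : ℂ) : ℝ := 2 * inner ℝ u (-Complex.I * N₁ α β u v)

/-- Local conservation of charge. The α term contributes nothing; the β term is a real symmetric
factor times Im(ū v), which is antisymmetric. -/
theorem chargeRate_swap (α β : ℝ) (u v : ℂ) :
    chargeRate α β v u = -chargeRate α β u v := by
  simp only [chargeRate, N₁_eq, Complex.inner]
  simp [← Complex.ofReal_pow]
  ring

theorem abs_chargeRate_le (α β : ℝ) (u v : ℂ) :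
    |chargeRate α β u v| ≤ 2 * (|α| + 4 * |β|) * ‖v‖ ^ 2 * ‖u‖ ^ 2 := by
  have h1 := abs_real_inner_le_norm u (-Complex.I * N₁ α β u v)
  have h2 := norm_N₁_le α β u v
  rw [norm_mul, norm_neg, Complex.norm_I, one_mul] at h1
  rw [chargeRate, abs_mul, abs_two]
  nlinarith [mul_le_mul_of_nonneg_left h2 (norm_nonneg u)]

theorem continuous_chargeRate (α β : ℝ) :
    Continuous fun p : ℂ × ℂ => chargeRate α β p.1 p.2 := by
  have := continuous_N₁ α β
  unfold chargeRate
  fun_prop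

/-! ### Charge balance on a characteristic triangle. -/

/-- Fubini's theorem on a triangle. -/
theorem integral_integral_triangle {g : ℝ → ℝ → ℝ} (hg : Continuous fun p : ℝ × ℝ => g p.1 p.2)
    {T : ℝ} (hT : 0 ≤ T) :
    ∫ τ in (0 : ℝ)..T, ∫ σ in (0 : ℝ)..τ, g τ σ = ∫ σ in (0 : ℝ)..T, ∫ τ in σ..T, g τ σ := by
  set S : Set (ℝ × ℝ) := {p | p.2 ≤ p.1}
  have hS : MeasurableSet S := measurableSet_le measurable_snd measurable_fst
  have hint : Integrable (Function.uncurry fun τ σ => S.indicator (fun p => g p.1 p.2) (τ, σ))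
      ((volume.restrict (Ioc 0 T)).prod (volume.restrict (Ioc 0 T))) := by
    rw [Measure.prod_restrict]
    refine Integrable.indicator (f := fun p : ℝ × ℝ => g p.1 p.2) ?_ hS
    have : IntegrableOn (fun p : ℝ × ℝ => g p.1 p.2) (Icc 0 T ×ˢ Icc 0 T) (volume.prod volume) :=
      hg.continuousOn.integrableOn_compact (isCompact_Icc.prod isCompact_Icc)
    exact this.mono_set (prod_mono Ioc_subset_Icc_self Ioc_subset_Icc_self)
  have hswap := integral_integral_swap hint
  rw [intervalIntegral.integral_of_le hT, intervalIntegral.integral_of_le hT]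
  convert hswap using 1
  · refine setIntegral_congr_fun measurableSet_Ioc fun τ hτ => ?_
    have : (fun σ => S.indicator (fun p => g p.1 p.2) (τ, σ)) = (Iic τ).indicator (g τ) := by
      ext σ
      by_cases h : σ ≤ τ <;> simp [S, h]
    simp only [this]
    rw [setIntegral_indicator measurableSet_Iic, intervalIntegral.integral_of_le hτ.1.le]
    congr 2
    ext σ
    simp only [mem_inter_iff, mem_Ioc, mem_Iic]
    constructor
    · rintro ⟨h1, h2⟩
      exact ⟨⟨h1, h2.trans hτ.2⟩, h2⟩
    · rintro ⟨⟨h1, -⟩, h2⟩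
      exact ⟨h1, h2⟩
  · refine setIntegral_congr_fun measurableSet_Ioc fun σ hσ => ?_
    have : (fun τ => S.indicator (fun p => g p.1 p.2) (τ, σ)) =
        (Ici σ).indicator (fun τ => g τ σ) := by
      ext τ
      by_cases h : σ ≤ τ <;> simp [S, h]
    simp only [this]
    rw [setIntegral_indicator measurableSet_Ici, intervalIntegral.integral_of_le hσ.2,
      ← integral_Icc_eq_integral_Ioc]
    congr 2
    ext τ
    simp only [mem_inter_iff, mem_Ioc, mem_Ici, mem_Icc]
    constructor
    · rintro ⟨h1, h2⟩
      exact ⟨⟨hσ.1.trans_le h1, h2⟩, h1⟩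
    · rintro ⟨⟨-, h1⟩, h2⟩
      exact ⟨h2, h1⟩

theorem intervalIntegral_comp_affine_le {q : ℝ → ℝ} (hq0 : ∀ x, 0 ≤ q x) (hq : Integrable q)
    (y : ℝ) {c T : ℝ} (hc : c ≠ 0) (hT : 0 ≤ T) :
    ∫ τ in (0 : ℝ)..T, q (y + c * τ) ≤ |c⁻¹| * ∫ x, q x := by
  have h1 : Integrable fun τ => q (y + c * τ) :=
    (integrable_comp_mul_left_iff (fun x => q (y + x)) hc).2 (hq.comp_add_left y)
  rw [intervalIntegral.integral_of_le hT]
  refine (setIntegral_le_integral h1 (Eventually.of_forall fun _ => hq0 _)).trans (le_of_eq ?_)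
  rw [Measure.integral_comp_mul_left (fun x => q (y + x)), integral_add_left_eq_self, smul_eq_mul]

/-- The charge that crosses a characteristic is bounded by the total initial charge. -/
theorem integral_flux_le {p q R : ℝ → ℝ → ℝ} (hp : Continuous fun z : ℝ × ℝ => p z.1 z.2)
    (hq : Continuous fun z : ℝ × ℝ => q z.1 z.2) (hR : Continuous fun z : ℝ × ℝ => R z.1 z.2)
    (hp0 : ∀ t x, 0 ≤ p t x) (hq0 : ∀ t x, 0 ≤ q t x)
    (hpi : Integrable (p 0)) (hqi : Integrable (q 0))
    (hpeq : ∀ y t, 0 ≤ t → p t (y + t) = p 0 y + ∫ τ in (0 : ℝ)..t, R τ (y + τ))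
    (hqeq : ∀ y t, 0 ≤ t → q t (y - t) = q 0 y - ∫ τ in (0 : ℝ)..t, R τ (y - τ))
    (y : ℝ) {T : ℝ} (hT : 0 ≤ T) :
    ∫ τ in (0 : ℝ)..T, q τ (y + τ) ≤ 1 / 2 * ((∫ x, p 0 x) + ∫ x, q 0 x) := by
  have hR1 : Continuous fun z : ℝ × ℝ => R z.2 (y + 2 * z.1 - z.2) :=
    hR.comp (by fun_prop : Continuous fun z : ℝ × ℝ => (z.2, y + 2 * z.1 - z.2))
  have hR2 : Continuous fun z : ℝ × ℝ => R z.2 (y + 2 * T + -2 * z.1 + z.2) :=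
    hR.comp (by fun_prop : Continuous fun z : ℝ × ℝ => (z.2, y + 2 * T + -2 * z.1 + z.2))
  have hp00 : Continuous (p 0) := hp.comp (by fun_prop : Continuous fun x : ℝ => ((0 : ℝ), x))
  have hq00 : Continuous (q 0) := hq.comp (by fun_prop : Continuous fun x : ℝ => ((0 : ℝ), x))
  have hI1 : Continuous fun τ => ∫ σ in (0 : ℝ)..τ, R σ (y + 2 * τ - σ) :=
    intervalIntegral.continuous_parametric_intervalIntegral_of_continuous hR1 continuous_id
  have hI2 : Continuous fun τ => ∫ σ in (0 : ℝ)..τ, R σ (y + 2 * T + -2 * τ + σ) :=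
    intervalIntegral.continuous_parametric_intervalIntegral_of_continuous hR2 continuous_id
  -- The triangle has vertices (y, 0), (y + 2T, 0), (y + T, T). On its left edge `q` is traced back
  -- to the base; in `hB` the same is done for `p` on the right edge.
  have hA : ∫ τ in (0 : ℝ)..T, q τ (y + τ) = (∫ τ in (0 : ℝ)..T, q 0 (y + 2 * τ)) -
      ∫ τ in (0 : ℝ)..T, ∫ σ in (0 : ℝ)..τ, R σ (y + 2 * τ - σ) := by
    rw [← intervalIntegral.integral_sub (f := fun τ => q 0 (y + 2 * τ))
      ((hq00.comp (by fun_prop : Continuous fun τ : ℝ => y + 2 * τ)).intervalIntegrable _ _) (hI1.intervalIntegrable _ _)]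
    refine intervalIntegral.integral_congr fun τ hτ => ?_
    rw [uIcc_of_le hT] at hτ
    rw [← hqeq _ _ hτ.1]
    congr 1
    ring
  have hB : ∫ τ in (0 : ℝ)..T, p τ (y + 2 * T - τ) =
      (∫ τ in (0 : ℝ)..T, p 0 (y + 2 * T + -2 * τ)) +
      ∫ τ in (0 : ℝ)..T, ∫ σ in (0 : ℝ)..τ, R σ (y + 2 * T + -2 * τ + σ) := by
    rw [← intervalIntegral.integral_add (f := fun τ => p 0 (y + 2 * T + -2 * τ))
      ((hp00.comp (by fun_prop :
        Continuous fun τ : ℝ => y + 2 * T + -2 * τ)).intervalIntegrable _ _) (hI2.intervalIntegrable _ _)]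
    refine intervalIntegral.integral_congr fun τ hτ => ?_
    rw [uIcc_of_le hT] at hτ
    rw [← hpeq _ _ hτ.1]
    congr 1
    ring
  -- Both sides are half of the integral of `R` over the triangle; at fixed height σ they differ by
  -- the substitution τ ↦ T + σ - τ. Adding `hA` and `hB` therefore cancels the exchange terms.
  have hD : ∫ τ in (0 : ℝ)..T, ∫ σ in (0 : ℝ)..τ, R σ (y + 2 * τ - σ) =
      ∫ τ in (0 : ℝ)..T, ∫ σ in (0 : ℝ)..τ, R σ (y + 2 * T + -2 * τ + σ) := by
    rw [integral_integral_triangle hR1 hT, integral_integral_triangle hR2 hT]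
    refine intervalIntegral.integral_congr fun σ _ => ?_
    have := intervalIntegral.integral_comp_sub_left (a := σ) (b := T)
      (fun τ => R σ (y + 2 * τ - σ)) (T + σ)
    simp only [add_sub_cancel_left, add_sub_cancel_right] at this
    rw [← this]
    refine intervalIntegral.integral_congr fun τ _ => ?_
    congr 1
    ring
  have hBnn : 0 ≤ ∫ τ in (0 : ℝ)..T, p τ (y + 2 * T - τ) :=
    intervalIntegral.integral_nonneg hT fun _ _ => hp0 _ _
  have h1 := intervalIntegral_comp_affine_le (hp0 0) hpi (y + 2 * T) (c := -2) (by norm_num) hT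
  have h2 := intervalIntegral_comp_affine_le (hq0 0) hqi y (c := 2) (by norm_num) hT
  have e1 : |(-2 : ℝ)⁻¹| = 1 / 2 := by rw [abs_of_neg (by norm_num)]; norm_num
  have e2 : |(2 : ℝ)⁻¹| = 1 / 2 := by rw [abs_of_pos (by norm_num)]; norm_num
  rw [e1] at h1
  rw [e2] at h2
  linarith

/-! ### Pointwise bounds for mild solutions. -/

/-- Continuous solutions of the system integrated along characteristics, with data in `L²`
vanishing at infinity. -/
structure IsMildSolution (α β : ℝ) (u v : ℝ → ℝ → ℂ) : Prop where
  continuous_u : Continuous fun p : ℝ × ℝ => u p.1 p.2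
  continuous_v : Continuous fun p : ℝ × ℝ => v p.1 p.2
  eq_u : ∀ y t, 0 ≤ t → u t (y + t) =
    u 0 y + ∫ τ in (0 : ℝ)..t, -Complex.I * N₁ α β (u τ (y + τ)) (v τ (y + τ))
  eq_v : ∀ y t, 0 ≤ t → v t (y - t) =
    v 0 y + ∫ τ in (0 : ℝ)..t, -Complex.I * N₁ α β (v τ (y - τ)) (u τ (y - τ))
  memLp_u : MemLp (u 0) 2 volume
  memLp_v : MemLp (v 0) 2 volume
  tendsto_u : Tendsto (u 0) (cocompact ℝ) (𝓝 0)
  tendsto_v : Tendsto (v 0) (cocompact ℝ) (𝓝 0)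

namespace IsMildSolution

variable {α β : ℝ} {u v : ℝ → ℝ → ℂ}

/-- The system is invariant under exchange of the components and reflection of space. -/
theorem swap (h : IsMildSolution α β u v) :
    IsMildSolution α β (fun t x => v t (-x)) (fun t x => u t (-x)) where
  continuous_u := h.continuous_v.comp (by fun_prop : Continuous fun p : ℝ × ℝ => (p.1, -p.2))
  continuous_v := h.continuous_u.comp (by fun_prop : Continuous fun p : ℝ × ℝ => (p.1, -p.2))
  eq_u y t ht := by
    have := h.eq_v (-y) t ht
    simpa only [neg_add, sub_eq_add_neg] using this
  eq_v y t ht := by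
    have := h.eq_u (-y) t ht
    simpa only [neg_sub, sub_neg_eq_add, neg_add_eq_sub] using this
  memLp_u := h.memLp_v.comp_measurePreserving (Measure.measurePreserving_neg volume)
  memLp_v := h.memLp_u.comp_measurePreserving (Measure.measurePreserving_neg volume)
  tendsto_u := h.tendsto_v.comp (Homeomorph.neg ℝ).isClosedEmbedding.tendsto_cocompact
  tendsto_v := h.tendsto_u.comp (Homeomorph.neg ℝ).isClosedEmbedding.tendsto_cocompact

theorem integrable_u (h : IsMildSolution α β u v) : Integrable fun x => ‖u 0 x‖ ^ 2 :=
  (memLp_two_iff_integrable_sq_norm h.memLp_u.1).1 h.memLp_u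

theorem integrable_v (h : IsMildSolution α β u v) : Integrable fun x => ‖v 0 x‖ ^ 2 :=
  (memLp_two_iff_integrable_sq_norm h.memLp_v.1).1 h.memLp_v

theorem continuous_u_line (h : IsMildSolution α β u v) (y : ℝ) :
    Continuous fun τ => u τ (y + τ) :=
  h.continuous_u.comp (by fun_prop : Continuous fun τ : ℝ => (τ, y + τ))

theorem continuous_v_line (h : IsMildSolution α β u v) (y : ℝ) :
    Continuous fun τ => v τ (y + τ) :=
  h.continuous_v.comp (by fun_prop : Continuous fun τ : ℝ => (τ, y + τ))

theorem continuous_N₁_line (h : IsMildSolution α β u v) (y : ℝ) :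
    Continuous fun τ => N₁ α β (u τ (y + τ)) (v τ (y + τ)) :=
  Continuous.comp (g := fun p : ℂ × ℂ => N₁ α β p.1 p.2)
    (f := fun τ => (u τ (y + τ), v τ (y + τ))) (continuous_N₁ α β) ((h.continuous_u_line y).prodMk (h.continuous_v_line y))

/-- The continuation, to all times, of the right-hand side of the mild equation is differentiable
and agrees with `u` at nonnegative times. -/
theorem exists_hasDerivAt (h : IsMildSolution α β u v) (y : ℝ) :
    ∃ g : ℝ → ℂ, (∀ t, 0 ≤ t → g t = u t (y + t)) ∧
      ∀ t, HasDerivAt g (-Complex.I * N₁ α β (u t (y + t)) (v t (y + t))) t := by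
  refine ⟨fun t => u 0 y + ∫ τ in (0 : ℝ)..t, -Complex.I * N₁ α β (u τ (y + τ)) (v τ (y + τ)),
    fun t ht => (h.eq_u y t ht).symm, fun t => ?_⟩
  have hc := continuous_const (y := -Complex.I) |>.mul (h.continuous_N₁_line y)
  exact (intervalIntegral.integral_hasDerivAt_right (hc.intervalIntegrable _ _)
    (hc.stronglyMeasurableAtFilter _ _) hc.continuousAt).const_add _

theorem norm_sq_eq (h : IsMildSolution α β u v) (y : ℝ) {t : ℝ} (ht : 0 ≤ t) :
    ‖u t (y + t)‖ ^ 2 = ‖u 0 y‖ ^ 2 +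
      ∫ τ in (0 : ℝ)..t, chargeRate α β (u τ (y + τ)) (v τ (y + τ)) := by
  obtain ⟨g, hg, hd⟩ := h.exists_hasDerivAt y
  have hgc : Continuous g := continuous_iff_continuousAt.2 fun t => (hd t).continuousAt
  have hN := h.continuous_N₁_line y
  have := intervalIntegral.integral_eq_sub_of_hasDerivAt (a := 0) (b := t)
    (fun τ _ => (hd τ).norm_sq) (Continuous.intervalIntegrable (by fun_prop) _ _)
  rw [hg t ht, hg 0 le_rfl, add_zero] at this
  rw [← sub_eq_iff_eq_add', ← this]
  refine intervalIntegral.integral_congr fun τ hτ => ?_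
  rw [uIcc_of_le ht] at hτ
  simp only [chargeRate, hg τ hτ.1]

theorem integral_norm_sq_le (h : IsMildSolution α β u v) (y : ℝ) {T : ℝ} (hT : 0 ≤ T) :
    ∫ τ in (0 : ℝ)..T, ‖v τ (y + τ)‖ ^ 2 ≤
      1 / 2 * ((∫ x, ‖u 0 x‖ ^ 2) + ∫ x, ‖v 0 x‖ ^ 2) := by
  refine integral_flux_le (p := fun t x => ‖u t x‖ ^ 2) (q := fun t x => ‖v t x‖ ^ 2)
    (R := fun t x => chargeRate α β (u t x) (v t x)) (h.continuous_u.norm.pow 2)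
    (h.continuous_v.norm.pow 2)
    (Continuous.comp (g := fun p : ℂ × ℂ => chargeRate α β p.1 p.2)
      (f := fun z : ℝ × ℝ => (u z.1 z.2, v z.1 z.2)) (continuous_chargeRate α β) (h.continuous_u.prodMk h.continuous_v))
    (fun _ _ => by positivity) (fun _ _ => by positivity)
    h.integrable_u h.integrable_v
    (fun y t ht => h.norm_sq_eq y ht) (fun y t ht => ?_) y hT
  have := h.swap.norm_sq_eq (-y) ht
  simp only [neg_add, neg_neg, chargeRate_swap α β (u _ _), intervalIntegral.integral_neg] at this
  simpa only [sub_eq_add_neg] using this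

/-- The solution is controlled pointwise by the free evolution of its initial data. -/
theorem exists_norm_le (h : IsMildSolution α β u v) :
    ∃ B : ℝ, 0 ≤ B ∧ ∀ y t, 0 ≤ t → ‖u t (y + t)‖ ≤ B * ‖u 0 y‖ := by
  set K : ℝ := 2 * (|α| + 4 * |β|)
  have hK : 0 ≤ K := by positivity
  set M : ℝ := 1 / 2 * ((∫ x, ‖u 0 x‖ ^ 2) + ∫ x, ‖v 0 x‖ ^ 2)
  -- Grönwall: |u|² grows at rate at most K |v|², and `M` bounds the integral of |v|² along any
  -- characteristic.
  refine ⟨√(Real.exp (K * M)), by positivity, fun y t ht => ?_⟩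
  obtain ⟨g, hg, hd⟩ := h.exists_hasDerivAt y
  have hvc := (h.continuous_v_line y).norm.pow 2
  set Q : ℝ → ℝ := fun t => ∫ τ in (0 : ℝ)..t, ‖v τ (y + τ)‖ ^ 2
  have hQ : ∀ t, HasDerivAt Q (‖v t (y + t)‖ ^ 2) t := fun t =>
    intervalIntegral.integral_hasDerivAt_right (hvc.intervalIntegrable _ _)
      (hvc.stronglyMeasurableAtFilter _ _) hvc.continuousAt
  have hF : ∀ t, HasDerivAt (fun t => ‖g t‖ ^ 2 * Real.exp (-(K * Q t)))
      (2 * inner ℝ (g t) (-Complex.I * N₁ α β (u t (y + t)) (v t (y + t))) *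
        Real.exp (-(K * Q t)) +
        ‖g t‖ ^ 2 * (Real.exp (-(K * Q t)) * -(K * ‖v t (y + t)‖ ^ 2))) t := fun t =>
    (hd t).norm_sq.mul (((hQ t).const_mul K).neg.exp)
  have hanti : AntitoneOn (fun t => ‖g t‖ ^ 2 * Real.exp (-(K * Q t))) (Ici 0) := by
    refine antitoneOn_of_deriv_nonpos (convex_Ici 0)
      (fun t _ => (hF t).continuousAt.continuousWithinAt)
      (fun t _ => (hF t).differentiableAt.differentiableWithinAt) fun t ht' => ?_
    rw [interior_Ici, mem_Ioi] at ht'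
    rw [(hF t).deriv, hg t ht'.le]
    have hr := (abs_le.1 (abs_chargeRate_le α β (u t (y + t)) (v t (y + t)))).2
    rw [chargeRate] at hr
    have := mul_le_mul_of_nonneg_right hr (Real.exp_pos (-(K * Q t))).le
    simp only [K] at this ⊢
    linarith
  have h1 := hanti (mem_Ici.2 le_rfl) (mem_Ici.2 ht) ht
  simp only [hg t ht, hg 0 le_rfl, add_zero, Q, intervalIntegral.integral_same, mul_zero, neg_zero,
    Real.exp_zero, mul_one] at h1
  have h2 : ‖u t (y + t)‖ ^ 2 ≤ Real.exp (K * M) * ‖u 0 y‖ ^ 2 := by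
    rw [Real.exp_neg, ← div_eq_mul_inv, div_le_iff₀ (Real.exp_pos _), mul_comm] at h1
    refine h1.trans ?_
    gcongr
    exact h.integral_norm_sq_le y ht
  refine le_of_sq_le_sq ?_ (by positivity)
  rw [mul_pow, Real.sq_sqrt (Real.exp_pos _).le]
  exact h2

end IsMildSolution

/-! ### Decay of the remainder and scattering. -/

theorem tendsto_integral_Ioi_zero {q : ℝ → ℝ} (hq : Integrable q) :
    Tendsto (fun z => ∫ x in Ioi z, q x) atTop (𝓝 0) := by
  have h := intervalIntegral_tendsto_integral_Ioi 0 hq.integrableOn tendsto_id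
  have h2 : Tendsto (fun z => (∫ x in Ioi 0, q x) - ∫ x in (0 : ℝ)..z, q x) atTop (𝓝 0) := by
    simpa using (tendsto_const_nhds (x := ∫ x in Ioi 0, q x)).sub h
  refine h2.congr fun z => ?_
  rw [← intervalIntegral.integral_Ioi_sub_Ioi' hq.integrableOn hq.integrableOn]
  ring

/-- The rest term of the scattering asymptotics, controlled by `‖a(x - t)‖ Φ(x + t)`, vanishes in
`L²` and uniformly as `t → ∞`. -/
theorem remainder_tendsto_zero {a : ℝ → ℂ} (hac : Continuous a) (ha : MemLp a 2 volume)
    (ha0 : Tendsto a (cocompact ℝ) (𝓝 0)) {Φ : ℝ → ℝ} (hΦ0 : ∀ z, 0 ≤ Φ z) (hΦ : Antitone Φ)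
    {Φmax : ℝ} (hΦmax : ∀ z, Φ z ≤ Φmax) (hΦlim : Tendsto Φ atTop (𝓝 0))
    {E : ℝ → ℝ → ℂ} (hE : ∀ t, 0 ≤ t → AEStronglyMeasurable (E t) volume)
    (hEle : ∀ y t, 0 ≤ t → ‖E t (y + t)‖ ≤ ‖a y‖ * Φ (y + 2 * t)) :
    (∀ t, 0 ≤ t → MemLp (E t) 2 volume) ∧
    Tendsto (fun t => ∫ x, ‖E t x‖ ^ 2) atTop (𝓝 0) ∧
    (∀ t, 0 ≤ t → BddAbove (range fun x => ‖E t x‖)) ∧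
    Tendsto (fun t => ⨆ x, ‖E t x‖) atTop (𝓝 0) := by
  have hΦmax0 : 0 ≤ Φmax := (hΦ0 0).trans (hΦmax 0)
  have hle : ∀ t, 0 ≤ t → ∀ x, ‖E t x‖ ≤ ‖a (x - t)‖ * Φ (x + t) := by
    intro t ht x
    have := hEle (x - t) t ht
    rwa [sub_add_cancel, show x - t + 2 * t = x + t by ring] at this
  obtain ⟨S, hS⟩ : ∃ S, ∀ y, ‖a y‖ ≤ S := by
    let a' : ZeroAtInftyContinuousMap ℝ ℂ := ⟨⟨a, hac⟩, ha0⟩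
    exact ⟨‖a'.toBCF‖, fun y => a'.toBCF.norm_coe_le_norm y⟩
  have hS0 : 0 ≤ S := (norm_nonneg _).trans (hS 0)
  refine ⟨fun t ht => ?_, ?_, fun t ht => ⟨S * Φmax, ?_⟩, ?_⟩
  · have h1 : MemLp (fun x => a (x - t)) 2 volume :=
      ha.comp_measurePreserving (measurePreserving_sub_right volume t)
    refine h1.of_le_mul (c := Φmax) (hE t ht) (Eventually.of_forall fun x => ?_)
    refine (hle t ht x).trans ?_
    rw [mul_comm]
    gcongr
    exact hΦmax _
  · have hshift : ∀ t, ∫ x, ‖E t x‖ ^ 2 = ∫ y, ‖E t (y + t)‖ ^ 2 := fun t =>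
      (integral_add_right_eq_self (fun x => ‖E t x‖ ^ 2) t).symm
    simp only [hshift]
    have hai : Integrable fun y => ‖a y‖ ^ 2 := (memLp_two_iff_integrable_sq_norm ha.1).1 ha
    rw [← integral_zero ℝ ℝ (μ := volume)]
    -- In the moving frame y = x - t the majorant does not depend on t, and the argument y + 2t of
    -- `Φ` tends to infinity for fixed y.
    refine tendsto_integral_filter_of_dominated_convergence (fun y => ‖a y‖ ^ 2 * Φmax ^ 2) ?_ ?_
      (hai.mul_const _) (Eventually.of_forall fun y => ?_)
    · filter_upwards [eventually_ge_atTop 0] with t ht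
      exact (((hE t ht).comp_measurePreserving (measurePreserving_add_right volume t)).norm.pow 2)
    · filter_upwards [eventually_ge_atTop 0] with t ht
      refine Eventually.of_forall fun y => ?_
      rw [Real.norm_of_nonneg (by positivity), ← mul_pow]
      gcongr
      refine (hEle y t ht).trans ?_
      gcongr
      exact hΦmax _
    · have h1 : Tendsto (fun t : ℝ => y + 2 * t) atTop atTop :=
        tendsto_atTop_add_const_left _ _ (tendsto_id.const_mul_atTop two_pos)
      have h2 : Tendsto (fun t => (‖a y‖ * Φ (y + 2 * t)) ^ 2) atTop (𝓝 0) := by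
        simpa using ((hΦlim.comp h1).const_mul ‖a y‖).pow 2
      refine squeeze_zero' (Eventually.of_forall fun t => by positivity) ?_ h2
      filter_upwards [eventually_ge_atTop 0] with t ht
      gcongr
      exact hEle y t ht
  · rintro _ ⟨x, rfl⟩
    exact (hle t ht x).trans (mul_le_mul (hS _) (hΦmax _) (hΦ0 _) hS0)
  · rw [Metric.tendsto_nhds]
    intro ε hε
    obtain ⟨δ, hδ, hδε⟩ : ∃ δ > 0, δ * (Φmax + S) < ε :=
      (exists_pos_mul_lt hε (Φmax + S)).imp fun δ h => ⟨h.1, by linarith [h.2]⟩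
    have hev : ∀ᶠ y in cocompact ℝ, ‖a y‖ < δ := by
      simpa using ha0.eventually (Metric.ball_mem_nhds _ hδ)
    rw [← Metric.cobounded_eq_cocompact, ← comap_norm_atTop, eventually_comap] at hev
    obtain ⟨R, hR⟩ := hev.exists_forall_of_atTop
    have h1 : Tendsto (fun t : ℝ => -R + 2 * t) atTop atTop :=
      tendsto_atTop_add_const_left _ _ (tendsto_id.const_mul_atTop two_pos)
    filter_upwards [eventually_ge_atTop 0, (hΦlim.comp h1).eventually_lt_const hδ] with t ht hΦt
    rw [Function.comp_apply] at hΦt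
    have hb : ∀ x, ‖E t x‖ ≤ δ * (Φmax + S) := by
      intro x
      refine (hle t ht x).trans ?_
      -- Far from the ray x = t the factor `a` is small; near it x + t > 2t - R, so `Φ` is small.
      rcases le_or_gt R ‖x - t‖ with hx | hx
      · have := (hR _ hx (x - t) rfl).le
        calc _ ≤ δ * Φmax := mul_le_mul this (hΦmax _) (hΦ0 _) hδ.le
          _ ≤ _ := by gcongr; linarith
      · have h2 : Φ (x + t) ≤ δ := by
          refine (hΦ ?_).trans hΦt.le
          rw [Real.norm_eq_abs, abs_lt] at hx
          linarith
        calc _ ≤ S * δ := mul_le_mul (hS _) h2 (hΦ0 _) hS0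
          _ = δ * S := mul_comm _ _
          _ ≤ _ := by gcongr; linarith
    rw [Real.dist_eq, sub_zero, abs_of_nonneg (Real.iSup_nonneg fun _ => norm_nonneg _)]
    exact (ciSup_le hb).trans_lt hδε

namespace IsMildSolution

variable {α β : ℝ} {u v : ℝ → ℝ → ℂ}

theorem scattering (h : IsMildSolution α β u v) :
    (∀ y, IntegrableOn (fun τ => N₁ α β (u τ (y + τ)) (v τ (y + τ))) (Ioi 0)) ∧
    (∀ t, 0 ≤ t → MemLp (fun x => u t x - u 0 (x - t) - G₁ α β u v (x - t)) 2 volume) ∧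
    Tendsto (fun t => ∫ x, ‖u t x - u 0 (x - t) - G₁ α β u v (x - t)‖ ^ 2) atTop (𝓝 0) ∧
    (∀ t, 0 ≤ t → BddAbove (range fun x =>
      ‖u t x - u 0 (x - t) - G₁ α β u v (x - t)‖)) ∧
    Tendsto (fun t => ⨆ x, ‖u t x - u 0 (x - t) - G₁ α β u v (x - t)‖) atTop (𝓝 0) := by
  obtain ⟨B, hB, hu⟩ := h.exists_norm_le
  obtain ⟨B', hB', hv'⟩ := h.swap.exists_norm_le
  -- The characteristic of v through (y + t, t) starts at y + 2t.
  have hv : ∀ y t, 0 ≤ t → ‖v t (y + t)‖ ≤ B' * ‖v 0 (y + 2 * t)‖ := by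
    intro y t ht
    have := hv' (-(y + 2 * t)) t ht
    simp only [neg_neg] at this
    rwa [show -(-(y + 2 * t) + t) = y + t by ring] at this
  set q : ℝ → ℝ := fun x => ‖v 0 x‖ ^ 2
  have hq : Integrable q := h.integrable_v
  have hq0 : ∀ x, 0 ≤ q x := fun x => by positivity
  set C : ℝ := (|α| + 4 * |β|) * B * B' ^ 2
  have hC : 0 ≤ C := by positivity
  have hN : ∀ y τ, 0 ≤ τ →
      ‖N₁ α β (u τ (y + τ)) (v τ (y + τ))‖ ≤ C * ‖u 0 y‖ * q (y + 2 * τ) := by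
    intro y τ hτ
    calc _ ≤ (|α| + 4 * |β|) * ‖u τ (y + τ)‖ * ‖v τ (y + τ)‖ ^ 2 := norm_N₁_le _ _ _ _
      _ ≤ (|α| + 4 * |β|) * (B * ‖u 0 y‖) * (B' * ‖v 0 (y + 2 * τ)‖) ^ 2 := by
        gcongr
        · exact hu y τ hτ
        · exact hv y τ hτ
      _ = _ := by simp only [C, q]; ring
  have hqa : ∀ y, Integrable fun τ => q (y + 2 * τ) := fun y =>
    (integrable_comp_mul_left_iff (fun x => q (y + x)) two_ne_zero).2 (hq.comp_add_left y)
  have hint : ∀ y, IntegrableOn (fun τ => N₁ α β (u τ (y + τ)) (v τ (y + τ))) (Ioi 0) := by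
    intro y
    refine Integrable.mono' (((hqa y).const_mul (C * ‖u 0 y‖)).integrableOn)
      (h.continuous_N₁_line y).aestronglyMeasurable.restrict ?_
    filter_upwards [ae_restrict_mem measurableSet_Ioi] with τ hτ
    exact hN y τ (mem_Ioi.1 hτ).le
  -- The error is exactly the part of the integral in `G₁` beyond time t.
  have hE : ∀ y t, 0 ≤ t → u t (y + t) - u 0 y - G₁ α β u v y =
      Complex.I * ∫ τ in Ioi t, N₁ α β (u τ (y + τ)) (v τ (y + τ)) := by
    intro y t ht
    have h1 := intervalIntegral.integral_Ioi_sub_Ioi (hint y) ht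
    rw [h.eq_u y t ht, intervalIntegral.integral_const_mul, ← h1, G₁]
    ring
  set Φ : ℝ → ℝ := fun z => C / 2 * ∫ x in Ioi z, q x
  have hEle : ∀ y t, 0 ≤ t →
      ‖u t (y + t) - u 0 y - G₁ α β u v y‖ ≤ ‖u 0 y‖ * Φ (y + 2 * t) := by
    intro y t ht
    rw [hE y t ht, norm_mul, Complex.norm_I, one_mul]
    have h2 : ∫ τ in Ioi t, q (y + 2 * τ) = 1 / 2 * ∫ x in Ioi (y + 2 * t), q x := by
      have h3 := integral_comp_mul_left_Ioi (fun x => q (y + x)) t two_pos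
      have h4 := (measurePreserving_add_left volume y).setIntegral_preimage_emb
        (measurableEmbedding_addLeft y) q (Ioi (y + 2 * t))
      rw [preimage_const_add_Ioi, add_sub_cancel_left] at h4
      rw [h3, h4]
      simp
    calc _ ≤ ∫ τ in Ioi t, C * ‖u 0 y‖ * q (y + 2 * τ) := by
          refine norm_integral_le_of_norm_le (((hqa y).const_mul _).integrableOn) ?_
          filter_upwards [ae_restrict_mem measurableSet_Ioi] with τ hτ
          exact hN y τ (ht.trans (mem_Ioi.1 hτ).le)
      _ = _ := by
          rw [integral_const_mul, h2]
          simp only [Φ]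
          ring
  have hu0 : Continuous (u 0) :=
    h.continuous_u.comp (by fun_prop : Continuous fun x : ℝ => ((0 : ℝ), x))
  have hΦlim : Tendsto Φ atTop (𝓝 0) := by
    simpa using (tendsto_integral_Ioi_zero hq).const_mul (C / 2)
  -- `G₁` is a pointwise limit of the continuous functions y ↦ u(y + n, n) - u₀(y).
  have hG : StronglyMeasurable (G₁ α β u v) := by
    refine stronglyMeasurable_of_tendsto atTop (f := fun (n : ℕ) y => u n (y + n) - u 0 y)
      (fun n => Continuous.stronglyMeasurable ?_) ?_
    · exact (h.continuous_u.comp (by fun_prop : Continuous fun y : ℝ => ((n : ℝ), y + n))).sub hu0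
    · rw [tendsto_pi_nhds]
      intro y
      rw [tendsto_iff_norm_sub_tendsto_zero]
      have h1 : Tendsto (fun n : ℕ => y + 2 * (n : ℝ)) atTop atTop :=
        tendsto_atTop_add_const_left _ _
          (tendsto_natCast_atTop_atTop.const_mul_atTop two_pos)
      refine squeeze_zero (fun _ => norm_nonneg _) (fun n => hEle y n n.cast_nonneg) ?_
      simpa using (hΦlim.comp h1).const_mul ‖u 0 y‖
  refine ⟨hint, remainder_tendsto_zero hu0 h.memLp_u h.tendsto_u (Φ := Φ) (Φmax := C / 2 * ∫ x, q x)
    (E := fun t x => u t x - u 0 (x - t) - G₁ α β u v (x - t)) ?_ ?_ ?_ hΦlim ?_ ?_⟩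
  · exact fun z => mul_nonneg (by positivity) (integral_nonneg hq0)
  · intro z z' hz
    simp only [Φ]
    gcongr ?_ * ?_
    exact setIntegral_mono_set hq.integrableOn (Eventually.of_forall hq0)
      (Ioi_subset_Ioi hz).eventuallyLE
  · intro z
    simp only [Φ]
    gcongr ?_ * ?_
    exact setIntegral_le_integral hq (Eventually.of_forall hq0)
  · intro t _
    have h1 : Continuous (u t) := h.continuous_u.comp (by fun_prop : Continuous fun x : ℝ => (t, x))
    exact ((h1.sub (hu0.comp (by fun_prop : Continuous fun x => x - t))).stronglyMeasurable.sub
      (hG.comp_measurable (by fun_prop))).aestronglyMeasurable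
  · intro y t ht
    simpa using hEle y t ht

theorem G₁_swap_neg (y : ℝ) :
    G₁ α β (fun t x => v t (-x)) (fun t x => u t (-x)) (-y) = G₂ α β u v y := by
  simp only [G₁, G₂, N₂_eq_N₁, neg_add, neg_neg, sub_eq_add_neg]

end IsMildSolution

/-! ### Application to Sobolev solutions. -/

/-- A solution, frozen at negative times, is a mild solution. -/
theorem IsSolution.isMildSolution {α β s : ℝ} (hs : 1 / 2 < s) {u₀ v₀ : ℝ → ℂ}
    {u v : ℝ → ℝ → ℂ} (h : IsSolution α β s u₀ v₀ u v) :
    IsMildSolution α β (fun t => u (max t 0)) (fun t => v (max t 0)) := by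
  have hcu := h.sobolev_u.continuous_uncurry hs h.continuous_u
  have hcv := h.sobolev_v.continuous_uncurry hs h.continuous_v
  -- Test functions do not see t ≤ 0, so freezing the solution there leaves the weak equations
  -- unchanged.
  have hsupp : ∀ {φ : ℝ × ℝ → ℂ}, IsTest φ → ∀ p : ℝ × ℝ, p.2 ≤ 0 → φ p = 0 ∧ fderiv ℝ φ p = 0 := by
    intro φ hφ p hp
    have hp' : p ∉ tsupport φ := fun hmem => (hφ.support hmem).not_ge hp
    refine ⟨image_eq_zero_of_notMem_tsupport hp', ?_⟩
    by_contra hne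
    exact hp' (support_fderiv_subset ℝ hne)
  refine ⟨hcu, hcv, fun y t ht => ?_, fun y t ht => ?_, ?_, ?_, ?_, ?_⟩
  · have := eq_add_integral_of_distribution 1 (f := fun t => u (max t 0))
      (F := fun t x => N₁ α β (u (max t 0) x) (v (max t 0) x)) hcu
      (Continuous.comp (g := fun p : ℂ × ℂ => N₁ α β p.1 p.2)
        (f := fun z : ℝ × ℝ => (u (max z.1 0) z.2, v (max z.1 0) z.2)) (continuous_N₁ α β)
        (hcu.prodMk hcv)) (fun φ hφ => ?_) y ht
    · simpa only [one_mul] using this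
    · convert h.eq_u φ hφ using 2
      · refine integral_congr_ae (Eventually.of_forall fun p => ?_)
        rcases le_or_gt p.2 0 with hp | hp
        · simp [(hsupp hφ p hp).2]
        · simp [max_eq_left hp.le]
      · ext p
        rcases le_or_gt p.2 0 with hp | hp
        · simp [(hsupp hφ p hp).1]
        · simp [max_eq_left hp.le]
  · have := eq_add_integral_of_distribution (-1) (f := fun t => v (max t 0))
      (F := fun t x => N₁ α β (v (max t 0) x) (u (max t 0) x)) hcv
      (Continuous.comp (g := fun p : ℂ × ℂ => N₁ α β p.1 p.2)
        (f := fun z : ℝ × ℝ => (v (max z.1 0) z.2, u (max z.1 0) z.2)) (continuous_N₁ α β)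
        (hcv.prodMk hcu)) (fun φ hφ => ?_) y ht
    · simpa only [neg_mul, one_mul, ← sub_eq_add_neg] using this
    · convert h.eq_v φ hφ using 2
      · refine integral_congr_ae (Eventually.of_forall fun p => ?_)
        rcases le_or_gt p.2 0 with hp | hp
        · simp [(hsupp hφ p hp).2]
        · simp [max_eq_left hp.le, sub_eq_add_neg]
      · ext p
        rcases le_or_gt p.2 0 with hp | hp
        · simp [(hsupp hφ p hp).1]
        · simp [max_eq_left hp.le, N₂_eq_N₁]
  · simpa using h.sobolev_u.1 0 le_rfl
  · simpa using h.sobolev_v.1 0 le_rfl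
  · simpa using h.sobolev_u.tendsto_cocompact hs h.continuous_u le_rfl
  · simpa using h.sobolev_v.tendsto_cocompact hs h.continuous_v le_rfl

end DiracAsymptotics

theorem theorem1 (α β s : ℝ) (hs : 1 / 2 < s) (u₀ v₀ : ℝ → ℂ) (u v : ℝ → ℝ → ℂ)
    (h : DiracAsymptotics.IsSolution α β s u₀ v₀ u v) :
    -- the integrals defining `G₁` and `G₂` converge absolutely at every point
    (∀ y : ℝ, IntegrableOn
      (fun τ : ℝ => DiracAsymptotics.N₁ α β (u τ (y + τ)) (v τ (y + τ))) (Ioi 0)) ∧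
    (∀ y : ℝ, IntegrableOn
      (fun τ : ℝ => DiracAsymptotics.N₂ α β (u τ (y - τ)) (v τ (y - τ))) (Ioi 0)) ∧
    -- convergence in `L²`, with finite integrals
    (∀ t : ℝ, 0 ≤ t →
      MemLp (fun x : ℝ => u t x - u₀ (x - t) - DiracAsymptotics.G₁ α β u v (x - t)) 2 volume) ∧
    Tendsto
      (fun t : ℝ => ∫ x : ℝ, ‖u t x - u₀ (x - t) - DiracAsymptotics.G₁ α β u v (x - t)‖ ^ 2)
      atTop (𝓝 0) ∧
    (∀ t : ℝ, 0 ≤ t →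
      MemLp (fun x : ℝ => v t x - v₀ (x + t) - DiracAsymptotics.G₂ α β u v (x + t)) 2 volume) ∧
    Tendsto
      (fun t : ℝ => ∫ x : ℝ, ‖v t x - v₀ (x + t) - DiracAsymptotics.G₂ α β u v (x + t)‖ ^ 2)
      atTop (𝓝 0) ∧
    -- uniform convergence, with finite suprema
    (∀ t : ℝ, 0 ≤ t → BddAbove (range fun x : ℝ =>
      ‖u t x - u₀ (x - t) - DiracAsymptotics.G₁ α β u v (x - t)‖)) ∧
    Tendsto
      (fun t : ℝ => ⨆ x : ℝ, ‖u t x - u₀ (x - t) - DiracAsymptotics.G₁ α β u v (x - t)‖)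
      atTop (𝓝 0) ∧
    (∀ t : ℝ, 0 ≤ t → BddAbove (range fun x : ℝ =>
      ‖v t x - v₀ (x + t) - DiracAsymptotics.G₂ α β u v (x + t)‖)) ∧
    Tendsto
      (fun t : ℝ => ⨆ x : ℝ, ‖v t x - v₀ (x + t) - DiracAsymptotics.G₂ α β u v (x + t)‖)
      atTop (𝓝 0) := by
  have hm := h.isMildSolution hs
  obtain ⟨hu1, hu2, hu3, hu4, hu5⟩ := hm.scattering
  -- The claims for v are those for u in the reflected, exchanged system; x ↦ -x carries them back.
  obtain ⟨hv1, hv2, hv3, hv4, hv5⟩ := hm.swap.scattering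
  have hG₁ : ∀ y, DiracAsymptotics.G₁ α β (fun t => u (max t 0)) (fun t => v (max t 0)) y =
      DiracAsymptotics.G₁ α β u v y := fun y => by
    rw [DiracAsymptotics.G₁, DiracAsymptotics.G₁]
    congr 1
    refine setIntegral_congr_fun measurableSet_Ioi fun τ hτ => ?_
    simp only [max_eq_left (mem_Ioi.1 hτ).le]
  have hG₂ : ∀ y, DiracAsymptotics.G₂ α β (fun t => u (max t 0)) (fun t => v (max t 0)) y =
      DiracAsymptotics.G₂ α β u v y := fun y => by
    rw [DiracAsymptotics.G₂, DiracAsymptotics.G₂]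
    congr 1
    refine setIntegral_congr_fun measurableSet_Ioi fun τ hτ => ?_
    simp only [max_eq_left (mem_Ioi.1 hτ).le]
  have hEu : ∀ t, 0 ≤ t → (fun x => u (max t 0) x - u (max 0 0) (x - t) -
      DiracAsymptotics.G₁ α β (fun t => u (max t 0)) (fun t => v (max t 0)) (x - t)) =
      fun x => u t x - u₀ (x - t) - DiracAsymptotics.G₁ α β u v (x - t) := fun t ht => by
    ext x
    rw [hG₁, max_eq_left ht, max_self, h.initial_u]
  have hEv : ∀ t, 0 ≤ t → (fun x => v (max t 0) (-x) - v (max 0 0) (-(x - t)) -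
      DiracAsymptotics.G₁ α β (fun t x => v (max t 0) (-x)) (fun t x => u (max t 0) (-x))
        (x - t)) =
      fun x => v t (-x) - v₀ (-x + t) - DiracAsymptotics.G₂ α β u v (-x + t) := fun t ht => by
    ext x
    have := DiracAsymptotics.IsMildSolution.G₁_swap_neg (α := α) (β := β)
      (u := fun t => u (max t 0)) (v := fun t => v (max t 0)) (-x + t)
    rw [neg_add, neg_neg, ← sub_eq_add_neg] at this
    rw [this, hG₂, max_eq_left ht, max_self, h.initial_v, neg_sub, neg_add_eq_sub]
  refine ⟨fun y => ?_, fun y => ?_, fun t ht => ?_, ?_, fun t ht => ?_, ?_, fun t ht => ?_, ?_,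
    fun t ht => ?_, ?_⟩
  · refine (hu1 y).congr_fun (fun τ hτ => ?_) measurableSet_Ioi
    simp only [max_eq_left (mem_Ioi.1 hτ).le]
  · refine (hv1 (-y)).congr_fun (fun τ hτ => ?_) measurableSet_Ioi
    simp only [max_eq_left (mem_Ioi.1 hτ).le, DiracAsymptotics.N₂_eq_N₁, neg_add, neg_neg,
      sub_eq_add_neg]
  · rw [← hEu t ht]
    exact hu2 t ht
  · refine hu3.congr' ?_
    filter_upwards [eventually_ge_atTop 0] with t ht
    exact integral_congr_ae (Eventually.of_forall fun x =>
      congrArg (fun z : ℂ => ‖z‖ ^ 2) (congrFun (hEu t ht) x))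
  · have := hv2 t ht
    rw [hEv t ht] at this
    simpa [Function.comp_def] using
      this.comp_measurePreserving (Measure.measurePreserving_neg volume)
  · refine hv3.congr' ?_
    filter_upwards [eventually_ge_atTop 0] with t ht
    rw [← integral_neg_eq_self]
    refine integral_congr_ae (Eventually.of_forall fun x => ?_)
    have := congrFun (hEv t ht) (-x)
    simp only [neg_neg] at this ⊢
    rw [this]
  · exact (congrArg (fun f : ℝ → ℂ => BddAbove (range fun x => ‖f x‖)) (hEu t ht)).mp (hu4 t ht)
  · refine hu5.congr' ?_
    filter_upwards [eventually_ge_atTop 0] with t ht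
    exact congrArg (fun f : ℝ → ℂ => ⨆ x, ‖f x‖) (hEu t ht)
  · have := (congrArg (fun f : ℝ → ℂ => BddAbove (range fun x => ‖f x‖)) (hEv t ht)).mp (hv4 t ht)
    refine this.mono ?_
    rintro _ ⟨x, rfl⟩
    exact ⟨-x, by simp only [neg_neg]⟩
  · refine hv5.congr' ?_
    filter_upwards [eventually_ge_atTop 0] with t ht
    refine (congrArg (fun f : ℝ → ℂ => ⨆ x, ‖f x‖) (hEv t ht)).trans ?_
    exact (Equiv.neg ℝ).iSup_comp (g := fun x =>
      ‖v t x - v₀ (x + t) - DiracAsymptotics.G₂ α β u v (x + t)‖)
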